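/- A partition structure is a family $p$ assigning to every $n\ge 1$ a probability distribution $p(\lambda)$, $\lambda\vdash n$, of a random partition $\pi_n$ of the integer $n$, which is sampling consistent: for all $m\le n$, if given $\pi_n$ one chooses a partition $\Pi_n$ of the set $[n]=\{1,\dots,n\}$ uniformly among those with block sizes $\pi_n$ and restricts it to $[m]$, then the block sizes of the restriction are distributed as $\pi_m$. Put $p(\varnothing)=1$. A deletion kernel $d$ assigns to every nonempty partition $\lambda$ of an integer a probability distribution $d(\lambda,\cdot)$ on the set of distinct part sizes of $\lambda$, with $d(\lambda,x)=0$ if $x$ is not a part of $\lambda$. Given $p$ and $d$, let $$q(n,x)=\sum_{\lambda\vdash n,\ x\in\lambda} d(\lambda,x)\,p(\lambda)\qquad(1\le x\le n).$$ The partition structure $p$ is regenerative with respect to $d$ if $$p(\lambda)\,d(\lambda,x)=q(n,x)\,p(\lambda-\{x\})\qquad\text{for all } n\ge1,\ \lambda\vdash n,\ x\in\lambda,$$ where $\lambda-\{x\}$ is obtained from $\lambda$ by deleting one part $x$; it is regenerative if for each $n$ this holds at level $n$ for some deletion kernel on the partitions of $n$. A partition is a hook if it has at most one part larger than $1$, and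 $p$ is a hook partition structure if $\pi_n$ is a hook with probability one for every $n$. **Corollary.** (1) Let $p$ be a partition structure that is regenerative with respect to $d$, with $p(2,2)>0$, and let $p'$ be a partition structure that is regenerative with respect to $d'$; write $q,q'$ for the associated deletion probabilities. Then for every $n\ge1$: (a) if $q(n,\cdot)=q'(n,\cdot)$, then $p(\lambda)=p'(\lambda)$ and $d(\lambda,\cdot)=d'(\lambda,\cdot)$ for all $\lambda\vdash n$; (b) if $p(\lambda)=p'(\lambda)$ for all $\lambda\vdash n$, then $q(n,\cdot)=q'(n,\cdot)$ and $d(\lambda,\cdot)=d'(\lambda,\cdot)$ for all $\lambda\vdash n$. In particular $q$ uniquely determines $p$ and $d$, and $p$ uniquely determines $q$ and $d$. (2) If $p$ is a regenerative partition structure that is not a hook partition structure, then there is exactly one deletion kernel $d$ with respect to which $p$ is regenerative. -/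

import Mathlib

namespace PartStruct

/-- The partition of the integer `n` given by the block sizes of a partition of the `n`-element set
`{0, …, n - 1}`. -/
def blockSizes {n : ℕ} (P : Finpartition (Finset.range n)) : n.Partition where
  parts := P.parts.val.map Finset.card
  parts_pos := by
    intro i hi
    obtain ⟨b, hb, rfl⟩ := Multiset.mem_map.1 hi
    exact Finset.card_pos.2 (P.nonempty_of_mem_parts hb)
  parts_sum := by
    have h := P.sum_card_parts
    rw [Finset.card_range] at h
    exact h

/-- Restriction of a partition of `{0, …, n - 1}` to `{0, …, m - 1}`. -/
def restrictTo {m n : ℕ} (h : m ≤ n) (P : Finpartition (Finset.range n)) :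
    Finpartition (Finset.range m) :=
  P.restrict (Finset.range_mono h)

/-- The law of the random partition of `m` derived by random sampling from a random partition
`π` of `n` with law `f`: given `π`, choose a partition of the set `{0, …, n - 1}` uniformly among
those with block sizes `π`, restrict it to `{0, …, m - 1}` and record the block sizes. -/
noncomputable def sampled {m n : ℕ} (h : m ≤ n) (f : n.Partition → ℝ) (μ : m.Partition) : ℝ :=
  ∑ P : Finpartition (Finset.range n) with blockSizes (restrictTo h P) = μ,
    f (blockSizes P) /
      (Finset.card {Q : Finpartition (Finset.range n) | blockSizes Q = blockSizes P} : ℝ)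

/-- A partition structure: a sampling consistent sequence of probability distributions on the
partitions of `n`. The sequence starts at `n = 0`, where the law is the point mass at the empty
partition; this is the convention `p(∅) = 1`. -/
structure IsPartitionStructure (p : ∀ n : ℕ, n.Partition → ℝ) : Prop where
  nonneg : ∀ n (l : n.Partition), 0 ≤ p n l
  sum_eq_one : ∀ n, ∑ l : n.Partition, p n l = 1
  consistent : ∀ m n (h : m ≤ n) (μ : m.Partition), p m μ = sampled h (p n) μ

/-- The partition of `n - x` obtained from a partition of `n` by deleting one part equal to `x`. -/
def deletePart {n : ℕ} (l : n.Partition) (x : ℕ) (hx : x ∈ l.parts) : (n - x).Partition where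
  parts := l.parts.erase x
  parts_pos := fun hi => l.parts_pos (Multiset.mem_of_mem_erase hi)
  parts_sum := by
    have h := Multiset.sum_erase hx
    rw [l.parts_sum] at h
    omega

/-- A deletion kernel on the partitions of `n`: for each partition `l` of `n`, a probability
distribution `d l` on the set of distinct part sizes of `l`. The empty partition, which has no part
to delete, is exempted from the normalisation (there `d` vanishes). -/
structure IsDeletionKernel (n : ℕ) (d : n.Partition → ℕ → ℝ) : Prop where
  nonneg : ∀ l x, 0 ≤ d l x
  eq_zero : ∀ l x, x ∉ l.parts → d l x = 0
  sum_eq_one : n ≠ 0 → ∀ l : n.Partition, ∑ x ∈ l.parts.toFinset, d l x = 1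

/-- The probability `q(n, x)` that the part deleted according to `d` from a random partition of `n`
with law `p n` has size `x`. -/
noncomputable def q (p : ∀ n : ℕ, n.Partition → ℝ) (n : ℕ) (d : n.Partition → ℕ → ℝ) (x : ℕ) : ℝ :=
  ∑ l : n.Partition with x ∈ l.parts, d l x * p n l

/-- `d` is a deletion kernel on the partitions of `n`, and the random partition of `n` with law
`p n` is regenerative with respect to `d`: given that the deleted part is `x`, the remaining
partition has law `p (n - x)`. -/
def RegenerativeAt (p : ∀ n : ℕ, n.Partition → ℝ) (n : ℕ) (d : n.Partition → ℕ → ℝ) : Prop :=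
  IsDeletionKernel n d ∧
    ∀ (l : n.Partition) (x : ℕ) (hx : x ∈ l.parts),
      p n l * d l x = q p n d x * p (n - x) (deletePart l x hx)

/-- The partition structure `p` is regenerative with respect to the deletion kernel `d`. -/
def RegenerativeWith (p : ∀ n : ℕ, n.Partition → ℝ) (d : ∀ n : ℕ, n.Partition → ℕ → ℝ) : Prop :=
  ∀ n, RegenerativeAt p n (d n)

/-- The partition structure `p` is regenerative: for each `n` its random partition of `n` is
regenerative with respect to some deletion kernel. -/
def IsRegenerative (p : ∀ n : ℕ, n.Partition → ℝ) : Prop :=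
  ∀ n, ∃ d : n.Partition → ℕ → ℝ, RegenerativeAt p n d

/-- A hook: a partition with at most one part larger than `1`. -/
def IsHook {n : ℕ} (l : n.Partition) : Prop :=
  (l.parts.filter (fun i => 1 < i)).card ≤ 1

instance {n : ℕ} (l : n.Partition) : Decidable (IsHook l) :=
  inferInstanceAs (Decidable (_ ≤ _))

/-- The random partition of `n` is a hook with probability one, for every `n`. -/
def IsHookStructure (p : ∀ n : ℕ, n.Partition → ℝ) : Prop :=
  ∀ n, ∑ l : n.Partition with IsHook l, p n l = 1

/-- The partition `(2, 2)` of `4`. -/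
def twoTwo : Nat.Partition 4 where
  parts := {2, 2}
  parts_pos := by
    intro i hi
    simp at hi
    omega
  parts_sum := by simp

end PartStruct

namespace PartStruct

/-! Write $E_n$ for expectation under `p n`. Two identities drive the proof. Sampling consistency
and exchangeability give $(n+1)E_nF=E_{n+1}[\text{sum of } F \text{ over all one-unit removals}]$
(`succ_mul_expect`). Regeneration gives $E_nF=\sum_x q(n,x)\,E_{n-x}F(x,\cdot)$ (`expect_eq_sum_q`).
Removing a unit from the second identity at level $n+1$ and comparing coefficients gives a downward
recursion in which $q(n+1,\cdot)$ determines $q(n,\cdot)$ (`q_recursion`).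

Coefficients may be compared once all-singleton partitions have positive mass
(`eq_of_sum_mul_expect_eq`). Then $p$ determines $q$, and $d$ follows by division wherever $p>0$.
Conversely, $q(n,\cdot)$ gives all lower $q(m,\cdot)$ by the recursion, and the regeneration
identity rebuilds $p$ from these (`eq_of_q_eq`).

It remains to see that $p(2,2)>0$ makes everything positive. Two sampled pairs in distinct blocks
force two arbitrarily large blocks (`exists_two_large_blocks`), so $p(k,k)>0$ and $q(2k,k)>0$.
Repeatedly adjoining a part equal to the current sum gives arbitrarily many large parts, and
lowering parts preserves positivity (`massOf_pos`). The recursion carries $q(2n,n)>0$ down to every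
$q(n,x)$ (`q_pos`). -/

open Finset

variable {m n : ℕ} {p p' : ∀ n : ℕ, n.Partition → ℝ}

/-! ### Exchangeable set partitions -/

/-- The positive sizes of the traces on `s` of the blocks of a partition of `{0, …, n - 1}`. -/
def traceSizes {n : ℕ} (P : Finpartition (range n)) (s : Finset ℕ) : Multiset ℕ :=
  (P.parts.val.map fun B => (B ∩ s).card).filter (0 < ·)

theorem parts_blockSizes_restrictTo (h : m ≤ n) (P : Finpartition (range n)) :
    (blockSizes (restrictTo h P)).parts = traceSizes P (range m) := by
  have hinj : Set.InjOn (· ∩ range m) (P.parts.filter (· ∩ range m ≠ ∅)) := by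
    intro x hx y hy hxy
    simp only [coe_filter, Set.mem_ofPred_eq] at hx hy
    obtain ⟨a, ha⟩ := nonempty_iff_ne_empty.2 hx.2
    have hb : a ∈ y ∩ range m := by
      have : x ∩ range m = y ∩ range m := hxy
      exact this ▸ ha
    exact P.eq_of_mem_parts hx.1 hy.1 (mem_inter.1 ha).1 (mem_inter.1 hb).1
  have hparts : (restrictTo h P).parts = (P.parts.filter (· ∩ range m ≠ ∅)).image (· ∩ range m) := by
    ext b
    simp only [restrictTo, Finpartition.restrict, mem_erase, mem_image, mem_filter, inf_eq_inter,
      bot_eq_empty]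
    constructor
    · rintro ⟨hb, a, ha, rfl⟩
      exact ⟨a, ⟨ha, hb⟩, rfl⟩
    · rintro ⟨a, ⟨ha, hb⟩, rfl⟩
      exact ⟨hb, a, ha, rfl⟩
  simp only [blockSizes, hparts, traceSizes]
  rw [image_val_of_injOn hinj, filter_val, Multiset.map_map, Multiset.filter_map]
  congr 1
  refine Multiset.filter_congr fun B _ => ?_
  simp [card_pos, nonempty_iff_ne_empty]

theorem traceSizes_range (P : Finpartition (range n)) :
    traceSizes P (range n) = (blockSizes P).parts := by
  have h : P.parts.val.map (fun B => (B ∩ range n).card) = P.parts.val.map card :=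
    Multiset.map_congr rfl fun B hB => by rw [inter_eq_left.2 (P.le hB)]
  rw [traceSizes, h]
  exact Multiset.filter_eq_self.2 fun x hx => (blockSizes P).parts_pos hx

/-- The probability of the set partition `P` when, given its block sizes, distributed with law
`p n`, it is uniform. -/
noncomputable def setLaw (p : ∀ n : ℕ, n.Partition → ℝ) {n : ℕ} (P : Finpartition (range n)) : ℝ :=
  p n (blockSizes P) /
    (Finset.card {Q : Finpartition (range n) | blockSizes Q = blockSizes P} : ℝ)

/-- The expectation of a function of the parts of a random partition of `n` with law `p n`. -/
noncomputable def expect (p : ∀ n : ℕ, n.Partition → ℝ) (n : ℕ) (F : Multiset ℕ → ℝ) : ℝ :=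
  ∑ l : n.Partition, p n l * F l.parts

theorem setLaw_nonneg (hp : IsPartitionStructure p) (P : Finpartition (range n)) :
    0 ≤ setLaw p P :=
  div_nonneg (hp.nonneg _ _) (Nat.cast_nonneg _)

/-- Grouping set partitions by the shape of their restriction turns consistency into an identity for
arbitrary test functions, with all levels up to `n` living on one space. -/
theorem expect_eq_sum_setLaw (hp : IsPartitionStructure p) (h : m ≤ n) (F : Multiset ℕ → ℝ) :
    expect p m F = ∑ P : Finpartition (range n), setLaw p P * F (traceSizes P (range m)) := by
  rw [← sum_fiberwise (s := univ) (g := fun P => blockSizes (restrictTo h P)), expect]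
  refine sum_congr rfl fun μ _ => ?_
  rw [hp.consistent m n h μ, sampled, sum_mul]
  refine sum_congr rfl fun P hP => ?_
  rw [← parts_blockSizes_restrictTo h, (mem_filter.1 hP).2, setLaw]

theorem expect_eq_sum_setLaw_self (hp : IsPartitionStructure p) (F : Multiset ℕ → ℝ) :
    expect p n F = ∑ P : Finpartition (range n), setLaw p P * F (blockSizes P).parts := by
  simp_rw [expect_eq_sum_setLaw hp le_rfl, traceSizes_range]

theorem sum_setLaw (hp : IsPartitionStructure p) (n : ℕ) :
    ∑ P : Finpartition (range n), setLaw p P = 1 := by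
  have h := expect_eq_sum_setLaw_self (n := n) hp fun _ => 1
  simp only [expect, mul_one, hp.sum_eq_one] at h
  exact h.symm

/-- The image of a partition of `{0, …, n - 1}` under the transposition of `i` and `j`. -/
def swapLabels {i j : ℕ} (hi : i < n) (hj : j < n) (P : Finpartition (range n)) :
    Finpartition (range n) where
  parts := P.parts.map (Equiv.swap i j).finsetCongr.toEmbedding
  supIndep := by
    rw [Finset.supIndep_iff_pairwiseDisjoint]
    intro x hx y hy hxy
    simp only [coe_map, Set.mem_image, mem_coe] at hx hy
    obtain ⟨a, ha, rfl⟩ := hx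
    obtain ⟨b, hb, rfl⟩ := hy
    have hab : a ≠ b := fun h => hxy (h ▸ rfl)
    simpa [Function.onFun] using P.disjoint ha hb hab
  sup_parts := by
    ext x
    rw [mem_sup]
    simp only [mem_map, Equiv.coe_toEmbedding, Equiv.finsetCongr_apply, id]
    have key : ∀ x, x < n → Equiv.swap i j x < n := by
      intro x hx
      rw [Equiv.swap_apply_def]
      split_ifs <;> assumption
    constructor
    · rintro ⟨_, ⟨B, hB, rfl⟩, hx⟩
      obtain ⟨y, hy, rfl⟩ := mem_map.1 hx
      exact mem_range.2 (key _ (mem_range.1 (P.le hB hy)))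
    · intro hx
      obtain ⟨B, hB, hxB⟩ := P.exists_mem (mem_range.2 (key _ (mem_range.1 hx)))
      exact ⟨_, ⟨B, hB, rfl⟩, mem_map.2 ⟨_, hxB, by simp⟩⟩
  bot_notMem := by
    simp only [bot_eq_empty, mem_map, Equiv.coe_toEmbedding, Equiv.finsetCongr_apply, map_eq_empty,
      not_exists, not_and]
    rintro x hx rfl
    exact P.empty_notMem_parts hx

theorem swapLabels_swapLabels {i j : ℕ} (hi : i < n) (hj : j < n) (P : Finpartition (range n)) :
    swapLabels hi hj (swapLabels hi hj P) = P := by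
  ext1
  simp only [swapLabels]
  rw [map_map]
  convert! map_refl
  ext B x
  simp

theorem blockSizes_swapLabels {i j : ℕ} (hi : i < n) (hj : j < n) (P : Finpartition (range n)) :
    blockSizes (swapLabels hi hj P) = blockSizes P := by
  ext1
  simp [blockSizes, swapLabels, Multiset.map_map, Function.comp_def]

theorem traceSizes_swapLabels {i j : ℕ} (hi : i < n) (hj : j < n) (P : Finpartition (range n))
    (s : Finset ℕ) :
    traceSizes (swapLabels hi hj P) s = traceSizes P (s.map (Equiv.swap i j).toEmbedding) := by
  simp only [traceSizes, swapLabels, map_val, Multiset.map_map, Function.comp_def,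
    Equiv.coe_toEmbedding, Equiv.finsetCongr_apply]
  congr 1
  refine Multiset.map_congr rfl fun B _ => ?_
  rw [← card_map (Equiv.swap i j).toEmbedding (s := B.map _ ∩ s), map_inter, map_map]
  congr 2
  ext x
  simp

theorem sum_setLaw_swapLabels {i j : ℕ} (hi : i < n) (hj : j < n)
    (Φ : Finpartition (range n) → ℝ) :
    ∑ P, setLaw p P * Φ (swapLabels hi hj P) = ∑ P, setLaw p P * Φ P := by
  refine Fintype.sum_equiv
    (Function.Involutive.toPerm _ (swapLabels_swapLabels hi hj)) _ _ fun P => ?_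
  change _ = setLaw p (swapLabels hi hj P) * Φ (swapLabels hi hj P)
  simp [setLaw, blockSizes_swapLabels]

/-! ### Removing one unit at random -/

/-- Lower one part `y` of `s` by one, dropping it when it becomes zero. -/
def lowerPart (s : Multiset ℕ) (y : ℕ) : Multiset ℕ :=
  ((y - 1) ::ₘ s.erase y).filter (0 < ·)

/-- Sum of `F` over the outcomes of the removal of one unit from the parts of `s`. -/
def sumLower (F : Multiset ℕ → ℝ) (s : Multiset ℕ) : ℝ :=
  (s.map fun y : ℕ => (y : ℝ) * F (lowerPart s y)).sum

theorem traceSizes_erase {P : Finpartition (range n)} {B : Finset ℕ} (hB : B ∈ P.parts) {i : ℕ}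
    (hi : i ∈ B) :
    traceSizes P ((range n).erase i) = lowerPart (blockSizes P).parts B.card := by
  have hval : P.parts.val = B ::ₘ P.parts.val.erase B := (Multiset.cons_erase hB).symm
  have hB' : (B ∩ (range n).erase i).card = B.card - 1 := by
    rw [← card_erase_of_mem hi, inter_erase, inter_eq_left.2 (P.le hB)]
  have hrest : ∀ C ∈ P.parts.val.erase B, (C ∩ (range n).erase i).card = C.card := by
    intro C hC
    have hC' := (Multiset.Nodup.mem_erase_iff P.parts.nodup).1 hC
    have hiC : i ∉ C := fun h => hC'.1 (P.eq_of_mem_parts hC'.2 hB h hi)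
    rw [inter_erase, inter_eq_left.2 (P.le hC'.2), erase_eq_of_notMem hiC]
  simp only [traceSizes, lowerPart, blockSizes]
  rw [hval, Multiset.map_cons, Multiset.map_cons, Multiset.erase_cons_head, hB',
    Multiset.map_congr rfl hrest]

theorem map_swap_range {i : ℕ} (hi : i < n + 1) :
    (range n).map (Equiv.swap i n).toEmbedding = (range (n + 1)).erase i := by
  ext x
  simp only [Finset.mem_map_equiv, Equiv.symm_swap, mem_range, mem_erase, Equiv.swap_apply_def]
  split_ifs <;> omega

/-- By exchangeability, deleting any of the `n + 1` elements leaves the same law as deleting the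
last one. Summing over the deleted element and grouping by its block weights each part by its size.
-/
theorem succ_mul_expect (hp : IsPartitionStructure p) (n : ℕ) (F : Multiset ℕ → ℝ) :
    ((n : ℝ) + 1) * expect p n F = expect p (n + 1) (sumLower F) := by
  have h1 : ∀ i ∈ range (n + 1), expect p n F = ∑ P : Finpartition (range (n + 1)),
      setLaw p P * F (traceSizes P ((range (n + 1)).erase i)) := by
    intro i hi
    rw [expect_eq_sum_setLaw hp n.le_succ,
      ← sum_setLaw_swapLabels (mem_range.1 hi) n.lt_succ_self]
    simp_rw [traceSizes_swapLabels, map_swap_range (mem_range.1 hi)]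
  have h2 : ((n : ℝ) + 1) * expect p n F = ∑ i ∈ range (n + 1), expect p n F := by
    simp
  rw [h2, sum_congr rfl h1, sum_comm, expect_eq_sum_setLaw_self hp]
  refine sum_congr rfl fun P _ => ?_
  rw [← mul_sum]
  congr 1
  calc ∑ i ∈ range (n + 1), F (traceSizes P ((range (n + 1)).erase i))
      = ∑ i ∈ P.parts.biUnion id, F (traceSizes P ((range (n + 1)).erase i)) := by
        rw [P.biUnion_parts]
    _ = ∑ B ∈ P.parts, ∑ i ∈ B, F (traceSizes P ((range (n + 1)).erase i)) :=
        sum_biUnion P.disjoint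
    _ = ∑ B ∈ P.parts, (B.card : ℝ) * F (lowerPart (blockSizes P).parts B.card) := by
        refine sum_congr rfl fun B hB => ?_
        rw [sum_congr rfl fun i hi => by rw [traceSizes_erase hB hi], sum_const, nsmul_eq_mul]
    _ = sumLower F (blockSizes P).parts := by
        simp only [sumLower, blockSizes, Multiset.map_map, Function.comp_def]
        rfl

theorem lowerPart_cons_of_mem {s : Multiset ℕ} {x y : ℕ} (hx : 0 < x) (hy : y ∈ s) :
    lowerPart (x ::ₘ s) y = x ::ₘ lowerPart s y := by
  rw [lowerPart, lowerPart, Multiset.erase_cons_tail_of_mem hy, Multiset.cons_swap,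
    Multiset.filter_cons_of_pos _ hx]

theorem lowerPart_cons_self (s : Multiset ℕ) (x : ℕ) :
    lowerPart (x ::ₘ s) x = ((x - 1) ::ₘ s).filter (0 < ·) := by
  rw [lowerPart, Multiset.erase_cons_head]

theorem sumLower_cons (F : Multiset ℕ → ℝ) (s : Multiset ℕ) {x : ℕ} (hx : 0 < x) :
    sumLower F (x ::ₘ s) =
      x * F (((x - 1) ::ₘ s).filter (0 < ·)) + sumLower (fun t => F (x ::ₘ t)) s := by
  rw [sumLower, Multiset.map_cons, Multiset.sum_cons, lowerPart_cons_self, sumLower]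
  congr 2
  exact Multiset.map_congr rfl fun y hy => by rw [lowerPart_cons_of_mem hx hy]

theorem expect_congr {F G : Multiset ℕ → ℝ}
    (h : ∀ s : Multiset ℕ, (∀ i ∈ s, 0 < i) → s.sum = n → F s = G s) :
    expect p n F = expect p n G :=
  sum_congr rfl fun l _ => by rw [h _ (fun _ => l.parts_pos) l.parts_sum]

/-! ### Positivity under lowering of parts -/

/-- The probability of the partition with parts `s`, zero if some element of `s` is zero. -/
noncomputable def massOf (p : ∀ n : ℕ, n.Partition → ℝ) (s : Multiset ℕ) : ℝ :=
  if h : ∀ i ∈ s, 0 < i then p s.sum ⟨s, fun {i} hi => h i hi, rfl⟩ else 0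

theorem massOf_parts (l : n.Partition) : massOf p l.parts = p n l := by
  obtain ⟨s, hs, rfl⟩ := l
  exact dif_pos fun i hi => hs hi

theorem massOf_nonneg (hp : IsPartitionStructure p) (s : Multiset ℕ) : 0 ≤ massOf p s := by
  rw [massOf]
  split_ifs
  exacts [hp.nonneg _ _, le_rfl]

theorem massOf_zero (hp : IsPartitionStructure p) : massOf p 0 = 1 := by
  have h := hp.sum_eq_one 0
  rw [Fintype.sum_unique, ← massOf_parts (p := p)] at h
  simpa using h

theorem pos_of_massOf_pos {s : Multiset ℕ} (h : 0 < massOf p s) : ∀ i ∈ s, 0 < i := by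
  by_contra hs
  rw [massOf, dif_neg hs] at h
  exact h.false

theorem expect_indicator {s : Multiset ℕ} (hn : s.sum = n) :
    expect p n (fun t => if t = s then 1 else 0) = massOf p s := by
  subst hn
  by_cases h : ∀ i ∈ s, 0 < i
  · rw [massOf, dif_pos h, expect, sum_eq_single ⟨s, fun {i} hi => h i hi, rfl⟩]
    · simp
    · intro l _ hl
      have : l.parts ≠ s := fun h => hl (Nat.Partition.ext h)
      simp [this]
    · simp
  · rw [massOf, dif_neg h]
    refine sum_eq_zero fun l _ => ?_
    have : l.parts ≠ s := by
      intro hl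
      exact h fun i hi => l.parts_pos (by rw [hl]; exact hi)
    simp [this]

theorem expect_mono (hp : IsPartitionStructure p) {F G : Multiset ℕ → ℝ} (h : ∀ s, F s ≤ G s) :
    expect p n F ≤ expect p n G :=
  sum_le_sum fun _ _ => mul_le_mul_of_nonneg_left (h _) (hp.nonneg _ _)

/-- The larger partition reaches the smaller one by a one-unit removal of weight at least 1, so the
test function indicating the smaller one bounds its mass below. -/
theorem massOf_pos_lower (hp : IsPartitionStructure p) {s : Multiset ℕ} {x : ℕ}
    (h : 0 < massOf p (x ::ₘ s)) : 0 < massOf p (((x - 1) ::ₘ s).filter (0 < ·)) := by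
  have hpos := pos_of_massOf_pos h
  have hx : 0 < x := hpos x (Multiset.mem_cons_self _ _)
  have hs : ∀ i ∈ s, 0 < i := fun i hi => hpos i (Multiset.mem_cons_of_mem hi)
  set t := ((x - 1) ::ₘ s).filter (0 < ·) with ht
  have hsum : t.sum + 1 = (x ::ₘ s).sum := by
    have hfs : s.filter (0 < ·) = s := Multiset.filter_eq_self.2 hs
    rw [ht, Multiset.filter_cons, hfs]
    split_ifs with h0
    · simp; omega
    · simp; omega
  have key := succ_mul_expect hp t.sum fun u => if u = t then 1 else 0
  rw [expect_indicator rfl] at key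
  have hle : massOf p (x ::ₘ s) ≤
      expect p (t.sum + 1) (sumLower fun u => if u = t then 1 else 0) := by
    rw [← expect_indicator hsum.symm]
    refine expect_mono hp fun u => ?_
    split_ifs with hu
    · subst hu
      rw [sumLower_cons _ _ hx, ← ht, if_pos rfl]
      have h1 : (1 : ℝ) ≤ x := by exact_mod_cast hx
      have h2 : 0 ≤ sumLower (fun v => if x ::ₘ v = t then (1 : ℝ) else 0) s := by
        refine Multiset.sum_nonneg fun r hr => ?_
        obtain ⟨y, _, rfl⟩ := Multiset.mem_map.1 hr
        dsimp only
        positivity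
      linarith
    · refine Multiset.sum_nonneg fun r hr => ?_
      obtain ⟨y, _, rfl⟩ := Multiset.mem_map.1 hr
      dsimp only
      positivity
  have h3 : 0 < ((t.sum : ℝ) + 1) * massOf p t := by linarith
  exact pos_of_mul_pos_right h3 (by positivity)

theorem massOf_pos_of_cons (hp : IsPartitionStructure p) {s : Multiset ℕ} {x : ℕ}
    (h : 0 < massOf p (x ::ₘ s)) : 0 < massOf p s := by
  induction x with
  | zero => exact absurd (pos_of_massOf_pos h 0 (Multiset.mem_cons_self _ _)) (lt_irrefl _)
  | succ x ih =>
    have hs : s.filter (0 < ·) = s := Multiset.filter_eq_self.2 fun i hi =>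
      pos_of_massOf_pos h i (Multiset.mem_cons_of_mem hi)
    have h1 := massOf_pos_lower hp h
    rw [Nat.add_sub_cancel] at h1
    rcases Nat.eq_zero_or_pos x with rfl | hx
    · rwa [Multiset.filter_cons_of_neg (p := (0 < ·)) _ (lt_irrefl 0), hs] at h1
    · rw [Multiset.filter_cons_of_pos (p := (0 < ·)) _ hx, hs] at h1
      exact ih h1

theorem massOf_pos_cons_of_le (hp : IsPartitionStructure p) {s : Multiset ℕ} {x y : ℕ}
    (hy : 0 < y) (hyx : y ≤ x) (h : 0 < massOf p (x ::ₘ s)) : 0 < massOf p (y ::ₘ s) := by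
  induction x, hyx using Nat.le_induction with
  | base => exact h
  | succ x hyx ih =>
    have hs : s.filter (0 < ·) = s := Multiset.filter_eq_self.2 fun i hi =>
      pos_of_massOf_pos h i (Multiset.mem_cons_of_mem hi)
    have h1 := massOf_pos_lower hp h
    rw [Nat.add_sub_cancel, Multiset.filter_cons_of_pos _ (hy.trans_le hyx), hs] at h1
    exact ih h1

theorem massOf_pos_of_add (hp : IsPartitionStructure p) {s t : Multiset ℕ}
    (h : 0 < massOf p (s + t)) : 0 < massOf p t := by
  induction s using Multiset.induction with
  | empty => simpa using h
  | cons x s ih =>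
    rw [Multiset.cons_add] at h
    exact ih (massOf_pos_of_cons hp h)

/-! ### The regeneration identity -/

/-- The partition of `n` obtained from a partition of `n - x` by adding a part `x`. -/
def insertPart {x : ℕ} (hx : 0 < x) (hxn : x ≤ n) (l : (n - x).Partition) : n.Partition where
  parts := x ::ₘ l.parts
  parts_pos := by
    intro i hi
    rcases Multiset.mem_cons.1 hi with rfl | hi
    exacts [hx, l.parts_pos hi]
  parts_sum := by rw [Multiset.sum_cons, l.parts_sum]; omega

theorem sum_massOf_erase {x : ℕ} (hx : 0 < x) (hxn : x ≤ n) (F : Multiset ℕ → ℝ) :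
    ∑ l : n.Partition with x ∈ l.parts, massOf p (l.parts.erase x) * F l.parts =
      expect p (n - x) fun s => F (x ::ₘ s) := by
  refine sum_bij' (fun l hl => deletePart l x (mem_filter.1 hl).2)
    (fun l _ => insertPart hx hxn l) ?_ ?_ ?_ ?_ ?_
  · simp
  · simp [insertPart]
  · intro l hl
    ext1
    exact Multiset.cons_erase (mem_filter.1 hl).2
  · intro l _
    ext1
    simp [insertPart, deletePart]
  · intro l hl
    rw [← massOf_parts (p := p)]
    simp [deletePart, Multiset.cons_erase (mem_filter.1 hl).2]

section Regenerative

variable {d : n.Partition → ℕ → ℝ}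

theorem RegenerativeAt.mul_eq (hr : RegenerativeAt p n d) {l : n.Partition} {x : ℕ}
    (hx : x ∈ l.parts) : p n l * d l x = q p n d x * massOf p (l.parts.erase x) := by
  rw [hr.2 l x hx, ← massOf_parts (p := p)]
  rfl

/-- Condition on the deleted part: the kernel weights sum to 1, and what remains has the law at
level `n - x`. -/
theorem expect_eq_sum_q (hr : RegenerativeAt p n d) (hn : n ≠ 0) (F : Multiset ℕ → ℝ) :
    expect p n F = ∑ x ∈ Icc 1 n, q p n d x * expect p (n - x) fun s => F (x ::ₘ s) := by
  have h1 : ∀ l : n.Partition, p n l * F l.parts = ∑ x ∈ Icc 1 n,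
      if x ∈ l.parts then q p n d x * (massOf p (l.parts.erase x) * F l.parts) else 0 := by
    intro l
    have hl : (Icc 1 n).filter (· ∈ l.parts) = l.parts.toFinset := by
      ext x
      simp only [mem_filter, mem_Icc, Multiset.mem_toFinset, and_iff_right_iff_imp]
      exact fun hx => ⟨l.parts_pos hx, (Multiset.le_sum_of_mem hx).trans_eq l.parts_sum⟩
    rw [← sum_filter, hl]
    calc p n l * F l.parts = p n l * F l.parts * ∑ x ∈ l.parts.toFinset, d l x := by
          rw [hr.1.sum_eq_one hn, mul_one]
      _ = _ := by
          rw [mul_sum]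
          refine sum_congr rfl fun x hx => ?_
          rw [← mul_assoc, ← hr.mul_eq (Multiset.mem_toFinset.1 hx)]
          ring
  rw [expect, sum_congr rfl fun l _ => h1 l, sum_comm]
  refine sum_congr rfl fun x hx => ?_
  rw [← sum_massOf_erase (mem_Icc.1 hx).1 (mem_Icc.1 hx).2, mul_sum, sum_filter]

theorem q_nonneg (hp : IsPartitionStructure p) (hd : IsDeletionKernel n d) (x : ℕ) :
    0 ≤ q p n d x :=
  sum_nonneg fun _ _ => mul_nonneg (hd.nonneg _ _) (hp.nonneg _ _)

theorem IsDeletionKernel.le_one (hd : IsDeletionKernel n d) (l : n.Partition) {x : ℕ}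
    (hx : x ∈ l.parts) : d l x ≤ 1 := by
  have hn : n ≠ 0 := by
    rintro rfl
    have h := Multiset.le_sum_of_mem hx
    rw [l.parts_sum] at h
    exact (l.parts_pos hx).ne' (Nat.le_zero.1 h)
  rw [← hd.sum_eq_one hn l]
  exact single_le_sum (fun y _ => hd.nonneg l y) (Multiset.mem_toFinset.2 hx)

theorem q_mul_massOf_le (hp : IsPartitionStructure p) (hr : RegenerativeAt p n d)
    {s : Multiset ℕ} {x : ℕ} (hx : 0 < x) (hs : x + s.sum = n) :
    q p n d x * massOf p s ≤ massOf p (x ::ₘ s) := by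
  by_cases hpos : ∀ i ∈ s, 0 < i
  · let l : n.Partition := ⟨x ::ₘ s, fun {i} hi => by
      rcases Multiset.mem_cons.1 hi with rfl | hi
      exacts [hx, hpos i hi], by simp [hs]⟩
    have hxl : x ∈ l.parts := Multiset.mem_cons_self _ _
    have h := hr.mul_eq hxl
    have h1 : massOf p (x ::ₘ s) = p n l := massOf_parts l
    have h2 : l.parts.erase x = s := Multiset.erase_cons_head _ _
    rw [h2] at h
    rw [h1, ← h]
    exact mul_le_of_le_one_right (hp.nonneg _ _) (hr.1.le_one l hxl)
  · rw [massOf, dif_neg hpos, mul_zero]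
    exact massOf_nonneg hp _

theorem massOf_pos_cons_of_q_pos (hp : IsPartitionStructure p) (hr : RegenerativeAt p n d)
    {s : Multiset ℕ} {x : ℕ} (hx : 0 < x) (hs : x + s.sum = n) (hq : 0 < q p n d x)
    (h : 0 < massOf p s) : 0 < massOf p (x ::ₘ s) :=
  (mul_pos hq h).trans_le (q_mul_massOf_le hp hr hx hs)

end Regenerative

/-! ### The recursion for the deletion law -/

/-- A law on `{1, …, n}` is determined by its mixtures of the partition laws of lower order, as
soon as partitions into singletons have positive probability. -/
theorem eq_of_sum_mul_expect_eq {a b : ℕ → ℝ}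
    (hpos : ∀ k < n, 0 < massOf p (Multiset.replicate k 1))
    (h : ∀ F : Multiset ℕ → ℝ, ∑ x ∈ Icc 1 n, a x * expect p (n - x) (fun s => F (x ::ₘ s)) =
      ∑ x ∈ Icc 1 n, b x * expect p (n - x) (fun s => F (x ::ₘ s))) :
    ∀ x ∈ Icc 1 n, a x = b x := by
  -- Test against the indicator of the hook with parts $x,1,\dots,1$: only the terms $x$ and $1$
  -- survive. Hence $x=1$ is settled first, and every other $x$ follows from it.
  have key : ∀ x ∈ Icc 1 n, (∀ y ∈ Icc 1 n, y ∈ x ::ₘ Multiset.replicate (n - x) 1 → y ≠ x →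
      a y = b y) → a x = b x := by
    intro x hx hy
    set t := x ::ₘ Multiset.replicate (n - x) 1 with ht
    have h1 := h fun s => if s = t then 1 else 0
    rw [← sub_eq_zero, ← sum_sub_distrib, sum_eq_single_of_mem x hx] at h1
    · simp_rw [ht, Multiset.cons_inj_right] at h1
      rw [expect_indicator (by simp), ← sub_mul, mul_eq_zero, sub_eq_zero] at h1
      refine h1.resolve_right (hpos _ ?_).ne'
      have := mem_Icc.1 hx
      omega
    · intro y hyn hyx
      by_cases hyt : y ∈ t
      · rw [hy y hyn hyt hyx, sub_self]
      · have : ∀ s : Multiset ℕ, y ::ₘ s ≠ t := fun s hs => hyt (hs ▸ Multiset.mem_cons_self y s)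
        simp [expect, this]
  intro x hx
  refine key x hx fun y hy hyt hyx => ?_
  have hy1 : y = 1 := by
    rcases Multiset.mem_cons.1 hyt with h | h
    exacts [absurd h hyx, Multiset.eq_of_mem_replicate h]
  subst hy1
  refine key 1 hy fun z _ hzt hz => absurd ?_ hz
  rcases Multiset.mem_cons.1 hzt with h | h
  exacts [h, Multiset.eq_of_mem_replicate h]

/-- Removing one unit at random from the regeneration identity. -/
theorem succ_sub_q_mul_expect (hp : IsPartitionStructure p) {d : (n + 1).Partition → ℕ → ℝ}
    (hr : RegenerativeAt p (n + 1) d) (F : Multiset ℕ → ℝ) :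
    ((n : ℝ) + 1 - q p (n + 1) d 1) * expect p n F =
      ∑ x ∈ Icc 1 n, (((x : ℝ) + 1) * q p (n + 1) d (x + 1) +
        ((n : ℝ) + 1 - x) * q p (n + 1) d x) * expect p (n - x) fun s => F (x ::ₘ s) := by
  set Q := q p (n + 1) d with hQ
  have h1 : ∀ x ∈ Icc 1 (n + 1), Q x * expect p (n + 1 - x) (fun s => sumLower F (x ::ₘ s)) =
      Q x * x * expect p (n + 1 - x) (fun s => F (((x - 1) ::ₘ s).filter (0 < ·))) +
      Q x * expect p (n + 1 - x) (sumLower fun t => F (x ::ₘ t)) := by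
    intro x hx
    simp only [expect, sumLower_cons F _ (mem_Icc.1 hx).1, mul_sum, ← sum_add_distrib]
    exact sum_congr rfl fun l _ => by ring
  -- The unit comes from the deleted part. If that part is 1 it disappears, leaving a plain `expect
  -- p n F`; otherwise the index shifts by one.
  have h2 : ∑ x ∈ Icc 1 (n + 1), Q x * x *
        expect p (n + 1 - x) (fun s => F (((x - 1) ::ₘ s).filter (0 < ·))) =
      Q 1 * expect p n F +
        ∑ x ∈ Icc 1 n, Q (x + 1) * ((x : ℝ) + 1) * expect p (n - x) fun s => F (x ::ₘ s) := by
    have hI : ∀ k, Icc 1 k = Ico 1 (k + 1) := fun k => by ext; simp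
    rw [hI, hI, sum_eq_sum_Ico_succ_bot (by simp),
      ← sum_Ico_add' _ 1 _ 1]
    have e : ∀ s : Multiset ℕ, (∀ i ∈ s, 0 < i) → s.filter (0 < ·) = s :=
      fun s hs => Multiset.filter_eq_self.2 hs
    congr 1
    · rw [Nat.cast_one, mul_one, Nat.add_sub_cancel]
      congr 1
      refine expect_congr fun s hs _ => ?_
      rw [Nat.sub_self, Multiset.filter_cons_of_neg (p := (0 < ·)) _ (lt_irrefl 0), e s hs]
    · refine sum_congr rfl fun x hx => ?_
      rw [Nat.add_sub_add_right, Nat.cast_add, Nat.cast_one]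
      congr 1
      refine expect_congr fun s hs _ => ?_
      rw [Nat.add_sub_cancel,
        Multiset.filter_cons_of_pos (p := (0 < ·)) _ (mem_Ico.1 hx).1, e s hs]
  -- The unit comes from the remainder, where the removal identity applies at level `n - x`. For `x
  -- = n + 1` the remainder is empty and contributes nothing.
  have h3 : ∑ x ∈ Icc 1 (n + 1), Q x * expect p (n + 1 - x) (sumLower fun t => F (x ::ₘ t)) =
      ∑ x ∈ Icc 1 n, Q x * ((n : ℝ) + 1 - x) * expect p (n - x) fun s => F (x ::ₘ s) := by
    rw [sum_Icc_succ_top (by omega), Nat.sub_self]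
    have h0 : expect p 0 (sumLower fun t => F ((n + 1) ::ₘ t)) = 0 := by
      simp [expect, sumLower]
    rw [h0, mul_zero, add_zero]
    refine sum_congr rfl fun x hx => ?_
    have hxn := (mem_Icc.1 hx).2
    rw [mul_assoc, Nat.succ_sub hxn, Nat.succ_eq_add_one, ← succ_mul_expect hp, Nat.cast_sub hxn]
    ring
  have h4 := succ_mul_expect hp n F
  rw [expect_eq_sum_q hr n.succ_ne_zero, sum_congr rfl h1, sum_add_distrib, h2, h3, add_assoc,
    ← sum_add_distrib] at h4
  rw [sub_mul, h4, add_sub_cancel_left]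
  exact sum_congr rfl fun x _ => by ring

/-- Size-biased thinning of the deletion law at level `n + 1` gives the one at level `n`. -/
theorem q_recursion (hp : IsPartitionStructure p) {d : n.Partition → ℕ → ℝ}
    {d' : (n + 1).Partition → ℕ → ℝ} (hr : RegenerativeAt p n d)
    (hr' : RegenerativeAt p (n + 1) d') (hpos : ∀ k < n, 0 < massOf p (Multiset.replicate k 1))
    {x : ℕ} (hx : x ∈ Icc 1 n) :
    ((n : ℝ) + 1 - q p (n + 1) d' 1) * q p n d x =
      ((x : ℝ) + 1) * q p (n + 1) d' (x + 1) + ((n : ℝ) + 1 - x) * q p (n + 1) d' x := by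
  refine eq_of_sum_mul_expect_eq
    (a := fun x => ((n : ℝ) + 1 - q p (n + 1) d' 1) * q p n d x)
    (b := fun x => ((x : ℝ) + 1) * q p (n + 1) d' (x + 1) +
      ((n : ℝ) + 1 - x) * q p (n + 1) d' x) hpos (fun F => ?_) x hx
  have hn : n ≠ 0 := by
    have := mem_Icc.1 hx
    omega
  rw [← succ_sub_q_mul_expect hp hr', expect_eq_sum_q hr hn, mul_sum]
  exact sum_congr rfl fun y _ => mul_assoc _ _ _

/-! ### Two arbitrarily large blocks -/

/-- `i` and `j` lie in a common block of `P` of size less than `k`. -/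
def SmallBlock (k : ℕ) {n : ℕ} (P : Finpartition (range n)) (i j : ℕ) : Prop :=
  ∃ B ∈ P.parts, i ∈ B ∧ j ∈ B ∧ B.card < k

open scoped Classical in
/-- The probability that `i` and `j` lie in a common block of size less than `k`. -/
noncomputable def smallBlockProb (p : ∀ n : ℕ, n.Partition → ℝ) (k n i j : ℕ) : ℝ :=
  ∑ P : Finpartition (range n), setLaw p P * if SmallBlock k P i j then 1 else 0

theorem smallBlock_swapLabels {k i j j' : ℕ} (hj : j < n) (hj' : j' < n) (hij : i ≠ j)
    (hij' : i ≠ j') (P : Finpartition (range n)) :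
    SmallBlock k (swapLabels hj hj' P) i j' ↔ SmallBlock k P i j := by
  simp only [SmallBlock, swapLabels, mem_map, Equiv.coe_toEmbedding, Equiv.finsetCongr_apply]
  constructor
  · rintro ⟨_, ⟨B, hB, rfl⟩, h1, h2, h3⟩
    rw [Finset.mem_map_equiv] at h1 h2
    rw [Equiv.symm_swap, Equiv.swap_apply_of_ne_of_ne hij hij'] at h1
    rw [Equiv.symm_swap, Equiv.swap_apply_right] at h2
    exact ⟨B, hB, h1, h2, by simpa using h3⟩
  · rintro ⟨B, hB, h1, h2, h3⟩
    refine ⟨_, ⟨B, hB, rfl⟩, ?_, ?_, by simpa using h3⟩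
    · rwa [Finset.mem_map_equiv, Equiv.symm_swap, Equiv.swap_apply_of_ne_of_ne hij hij']
    · rwa [Finset.mem_map_equiv, Equiv.symm_swap, Equiv.swap_apply_right]

theorem smallBlockProb_eq {k i j j' : ℕ} (hj : j < n) (hj' : j' < n) (hij : i ≠ j)
    (hij' : i ≠ j') : smallBlockProb p k n i j = smallBlockProb p k n i j' := by
  classical
  refine (sum_congr rfl fun P _ => congr_arg _ ?_).trans
    (sum_setLaw_swapLabels hj hj' fun P => if SmallBlock k P i j' then 1 else 0)
  exact if_congr (smallBlock_swapLabels hj hj' hij hij' P).symm rfl rfl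

/-- By exchangeability the left side is the expected number of elements other than `i` sharing a
small block with `i`, and such a block has fewer than `k` elements. -/
theorem mul_smallBlockProb_le (hp : IsPartitionStructure p) {k i j : ℕ} (hi : i < n) (hj : j < n)
    (hij : i ≠ j) : ((n : ℝ) - 1) * smallBlockProb p k n i j ≤ k := by
  classical
  have h1 : ((n : ℝ) - 1) * smallBlockProb p k n i j =
      ∑ j' ∈ (range n).erase i, smallBlockProb p k n i j' := by
    rw [sum_congr rfl fun j' hj' => (smallBlockProb_eq hj (mem_range.1 (mem_erase.1 hj').2) hij
      (mem_erase.1 hj').1.symm).symm, sum_const, card_erase_of_mem (mem_range.2 hi), card_range,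
      nsmul_eq_mul, Nat.cast_pred (by omega)]
  rw [h1]
  simp only [smallBlockProb]
  have h2 : (k : ℝ) = ∑ P : Finpartition (range n), setLaw p P * k := by
    rw [← sum_mul, sum_setLaw hp, one_mul]
  rw [sum_comm, h2]
  refine sum_le_sum fun P _ => ?_
  rw [← mul_sum]
  refine mul_le_mul_of_nonneg_left ?_ (setLaw_nonneg hp P)
  rw [sum_boole]
  by_cases h : (P.part i).card < k
  · refine le_trans ?_ (Nat.cast_le.2 h.le)
    refine Nat.cast_le.2 (card_le_card fun j' hj' => ?_)
    obtain ⟨B, hB, hiB, hjB, _⟩ := (mem_filter.1 hj').2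
    rwa [P.part_eq_of_mem hB hiB]
  · have : (filter (fun j' => SmallBlock k P i j') ((range n).erase i)) = ∅ := by
      refine filter_eq_empty_iff.2 fun j' _ hj' => h ?_
      obtain ⟨B, hB, hiB, _, hk⟩ := hj'
      rwa [P.part_eq_of_mem hB hiB]
    simp [this]

theorem exists_two_blocks {P : Finpartition (range n)} {s : Finset ℕ}
    (h : traceSizes P s = {2, 2}) :
    ∃ B ∈ P.parts, ∃ C ∈ P.parts, B ≠ C ∧ (B ∩ s).card = 2 ∧ (C ∩ s).card = 2 := by
  have h1 : (traceSizes P s).count 2 = 2 := by rw [h]; decide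
  rw [traceSizes, Multiset.count_filter_of_pos (by norm_num), Multiset.count_map] at h1
  have h2 : 1 < (P.parts.filter fun B => 2 = (B ∩ s).card).card := by
    have : (P.parts.filter fun B => 2 = (B ∩ s).card).card = 2 := h1
    omega
  obtain ⟨B, hB, C, hC, hBC⟩ := one_lt_card.1 h2
  exact ⟨B, (mem_filter.1 hB).1, C, (mem_filter.1 hC).1, hBC, (mem_filter.1 hB).2.symm,
    (mem_filter.1 hC).2.symm⟩

/-- Otherwise, whenever the first four elements show the pattern $(2,2)$, one of the two pairs lies
in a block smaller than `k`. A union bound makes this event $O(k/n)$, whereas consistency fixes its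
probability at $p(2,2)$. -/
theorem exists_two_large_blocks (hp : IsPartitionStructure p) (h22 : 0 < massOf p {2, 2}) (k : ℕ) :
    ∃ n, ∃ P : Finpartition (range n), 0 < setLaw p P ∧
      ∃ B ∈ P.parts, ∃ C ∈ P.parts, B ≠ C ∧ k ≤ B.card ∧ k ≤ C.card := by
  classical
  by_contra! hcon
  obtain ⟨N, hN⟩ := exists_nat_gt (16 * (k : ℝ) / massOf p {2, 2})
  rw [div_lt_iff₀ h22] at hN
  set n := N + 4 with hn
  have hT : ∀ P : Finpartition (range n),
      setLaw p P * (if traceSizes P (range 4) = {2, 2} then 1 else 0) ≤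
      setLaw p P * ∑ i ∈ range 4, ∑ j ∈ (range 4).erase i,
        if SmallBlock k P i j then (1 : ℝ) else 0 := by
    intro P
    rcases (setLaw_nonneg hp P).eq_or_lt with h0 | h0
    · simp [← h0]
    refine mul_le_mul_of_nonneg_left ?_ h0.le
    split_ifs with ht
    · have hsmall : ∃ D ∈ P.parts, D.card < k ∧ (D ∩ range 4).card = 2 := by
        obtain ⟨B, hB, C, hC, hBC, hB2, hC2⟩ := exists_two_blocks ht
        by_cases hBk : k ≤ B.card
        · exact ⟨C, hC, hcon n P h0 B hB C hC hBC hBk, hC2⟩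
        · exact ⟨B, hB, not_le.1 hBk, hB2⟩
      obtain ⟨D, hD, hDk, hD2⟩ := hsmall
      obtain ⟨i, hi, j, hj, hij⟩ := one_lt_card.1 (by omega : 1 < (D ∩ range 4).card)
      rw [mem_inter] at hi hj
      have hs : SmallBlock k P i j := ⟨D, hD, hi.1, hj.1, hDk⟩
      calc (1 : ℝ) = if SmallBlock k P i j then 1 else 0 := (if_pos hs).symm
        _ ≤ ∑ j ∈ (range 4).erase i, if SmallBlock k P i j then (1 : ℝ) else 0 :=
            single_le_sum (f := fun j => if SmallBlock k P i j then (1 : ℝ) else 0)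
              (fun _ _ => by positivity) (mem_erase.2 ⟨hij.symm, hj.2⟩)
        _ ≤ _ := single_le_sum (f := fun i => ∑ j ∈ (range 4).erase i,
              if SmallBlock k P i j then (1 : ℝ) else 0)
              (fun _ _ => sum_nonneg fun _ _ => by positivity) hi.2
    · exact sum_nonneg fun _ _ => sum_nonneg fun _ _ => by positivity
  have h1 : massOf p {2, 2} ≤
      ∑ i ∈ range 4, ∑ j ∈ (range 4).erase i, smallBlockProb p k n i j := by
    rw [← expect_indicator (n := 4) (by simp), expect_eq_sum_setLaw hp (by omega : 4 ≤ n)]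
    refine (sum_le_sum fun P _ => hT P).trans_eq ?_
    simp only [smallBlockProb, mul_sum]
    rw [sum_comm]
    exact sum_congr rfl fun i _ => sum_comm
  have h2 : ((n : ℝ) - 1) * massOf p {2, 2} ≤ 16 * k := by
    refine (mul_le_mul_of_nonneg_left h1 (by
      rw [hn]; push_cast; linarith [N.cast_nonneg (α := ℝ)])).trans ?_
    rw [mul_sum]
    -- There are 12 ordered pairs; the crude count $4\cdot4$ gives the 16 in the choice of `N`.
    calc _ ≤ ∑ i ∈ range 4, (4 : ℝ) * k := by
          refine sum_le_sum fun i hi => ?_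
          rw [mul_sum]
          refine (sum_le_card_nsmul _ _ (k : ℝ) fun j hj => ?_).trans ?_
          · have hi' := mem_range.1 hi
            have hj' := mem_range.1 (mem_erase.1 hj).2
            exact mul_smallBlockProb_le hp (by omega) (by omega) (mem_erase.1 hj).1.symm
          · rw [nsmul_eq_mul]
            refine mul_le_mul_of_nonneg_right ?_ (Nat.cast_nonneg _)
            have : ((range 4).erase i).card ≤ 4 := (card_le_card (erase_subset _ _)).trans (by simp)
            exact_mod_cast this
      _ = 16 * k := by simp; ring
  have h3 : (n : ℝ) - 1 = N + 3 := by rw [hn]; push_cast; ring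
  rw [h3] at h2
  linarith

theorem massOf_pair_pos (hp : IsPartitionStructure p) (h22 : 0 < massOf p {2, 2}) {k : ℕ}
    (hk : 0 < k) : 0 < massOf p {k, k} := by
  obtain ⟨n, P, hP, B, hB, C, hC, hBC, hBk, hCk⟩ := exists_two_large_blocks hp h22 k
  have hpos : 0 < massOf p (blockSizes P).parts := by
    rw [massOf_parts]
    refine (hp.nonneg _ _).lt_of_ne fun h => hP.ne' ?_
    rw [setLaw, ← h, zero_div]
  have hparts : P.parts.val = B ::ₘ C ::ₘ (P.parts.val.erase B).erase C := by
    rw [Multiset.cons_erase, Multiset.cons_erase hB]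
    exact (Multiset.mem_erase_of_ne hBC.symm).2 hC
  have h1 : (blockSizes P).parts =
      ((P.parts.val.erase B).erase C).map card + {B.card, C.card} := by
    change P.parts.val.map card = _
    conv_lhs => rw [hparts]
    rw [Multiset.map_cons, Multiset.map_cons, add_comm, Multiset.insert_eq_cons,
      Multiset.cons_add, Multiset.singleton_add]
  rw [h1] at hpos
  have h2 := massOf_pos_cons_of_le hp hk hBk (massOf_pos_of_add hp hpos)
  rw [← Multiset.cons_zero, Multiset.cons_swap] at h2
  have h3 := massOf_pos_cons_of_le hp hk hCk h2
  exact h3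

/-! ### Positivity of all masses and deletion probabilities -/

section

variable {d : ∀ n : ℕ, n.Partition → ℕ → ℝ}

/-- The partition $(k,k)$ has a single distinct part size, so its kernel weight is forced to be 1.
Regeneration then reads $p(k,k)=q(2k,k)\,p(k)$. -/
theorem q_double_pos (hp : IsPartitionStructure p) (hr : RegenerativeWith p d)
    (h22 : 0 < massOf p {2, 2}) {k : ℕ} (hk : 0 < k) :
    0 < q p (k + k) (d (k + k)) k := by
  refine (q_nonneg hp (hr _).1 k).lt_of_ne fun h => ?_
  let l : (k + k).Partition := ⟨{k, k}, fun {i} hi => by simp at hi; omega, by simp⟩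
  have hkl : k ∈ l.parts := by simp [l]
  have h1 := (hr (k + k)).mul_eq hkl
  have h2 : d (k + k) l k = 1 := by
    rw [← (hr (k + k)).1.sum_eq_one (by omega) l]
    simp [l]
  rw [← h, zero_mul, h2, mul_one, ← massOf_parts (p := p)] at h1
  exact (massOf_pair_pos hp h22 hk).ne' h1

theorem exists_massOf_pos_of_large_parts (hp : IsPartitionStructure p) (hr : RegenerativeWith p d)
    (h22 : 0 < massOf p {2, 2}) {K : ℕ} (hK : 0 < K) (r : ℕ) :
    ∃ s : Multiset ℕ, s.card = r ∧ (∀ i ∈ s, K ≤ i) ∧ 0 < massOf p s := by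
  -- Keeping the multiset nonempty ensures that its sum, used below as the new part, is at least
  -- `K`. The sum is chosen because the deletion probability of half the total is known to be
  -- positive.
  suffices h : ∃ s : Multiset ℕ, s.card = r + 1 ∧ (∀ i ∈ s, K ≤ i) ∧ 0 < massOf p s by
    obtain ⟨s, hs, hsK, hpos⟩ := h
    obtain ⟨x, hx⟩ := Multiset.card_pos_iff_exists_mem.1 (by omega : 0 < s.card)
    obtain ⟨t, rfl⟩ := Multiset.exists_cons_of_mem hx
    exact ⟨t, by simpa using hs, fun i hi => hsK i (Multiset.mem_cons_of_mem hi),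
      massOf_pos_of_cons hp hpos⟩
  induction r with
  | zero => exact ⟨{K}, by simp, by simp, massOf_pos_of_cons hp (massOf_pair_pos hp h22 hK)⟩
  | succ r ih =>
    obtain ⟨s, hs, hsK, hpos⟩ := ih
    obtain ⟨x, hx⟩ := Multiset.card_pos_iff_exists_mem.1 (by omega : 0 < s.card)
    have hsum : K ≤ s.sum := (hsK x hx).trans (Multiset.le_sum_of_mem hx)
    refine ⟨s.sum ::ₘ s, by simp [hs], fun i hi => ?_, ?_⟩
    · rcases Multiset.mem_cons.1 hi with rfl | hi
      exacts [hsum, hsK i hi]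
    · exact massOf_pos_cons_of_q_pos hp (hr _) (hK.trans_le hsum) rfl
        (q_double_pos hp hr h22 (hK.trans_le hsum)) hpos

theorem massOf_pos_of_le_parts (hp : IsPartitionStructure p) {K : ℕ} {s t u : Multiset ℕ}
    (hs : ∀ i ∈ s, 0 < i) (hsK : ∀ i ∈ s, i ≤ K) (ht : ∀ i ∈ t, K ≤ i) (hcard : t.card = s.card)
    (h : 0 < massOf p (t + u)) : 0 < massOf p (s + u) := by
  induction s using Multiset.induction generalizing t u with
  | empty =>
    rw [Multiset.card_zero, Multiset.card_eq_zero] at hcard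
    rwa [hcard] at h
  | cons b s ih =>
    obtain ⟨a, ha⟩ := Multiset.card_pos_iff_exists_mem.1
      (by rw [hcard, Multiset.card_cons]; omega : 0 < t.card)
    obtain ⟨t, rfl⟩ := Multiset.exists_cons_of_mem ha
    rw [Multiset.cons_add] at h
    have hb := Multiset.mem_cons_self b s
    have h1 := massOf_pos_cons_of_le hp (hs b hb) ((hsK b hb).trans (ht a ha)) h
    rw [← Multiset.add_cons] at h1
    have h2 := ih (fun i hi => hs i (Multiset.mem_cons_of_mem hi))
      (fun i hi => hsK i (Multiset.mem_cons_of_mem hi))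
      (fun i hi => ht i (Multiset.mem_cons_of_mem hi)) (by simpa using hcard) h1
    rwa [Multiset.add_cons, ← Multiset.cons_add] at h2

theorem massOf_pos (hp : IsPartitionStructure p) (hr : RegenerativeWith p d)
    (h22 : 0 < massOf p {2, 2}) {s : Multiset ℕ} (hs : ∀ i ∈ s, 0 < i) : 0 < massOf p s := by
  obtain ⟨t, htc, htK, ht⟩ :=
    exists_massOf_pos_of_large_parts hp hr h22 s.sum.succ_pos s.card
  have := massOf_pos_of_le_parts (u := 0) hp hs
    (fun i hi => (Multiset.le_sum_of_mem hi).trans s.sum.le_succ) htK htc (by simpa using ht)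
  simpa using this

theorem q_le_one (hp : IsPartitionStructure p) {d : n.Partition → ℕ → ℝ}
    (hd : IsDeletionKernel n d) (x : ℕ) : q p n d x ≤ 1 := by
  rw [← hp.sum_eq_one n]
  refine (sum_le_sum fun l hl => ?_).trans
    (sum_le_sum_of_subset_of_nonneg (filter_subset _ _) fun l _ _ => hp.nonneg n l)
  exact mul_le_of_le_one_left (hp.nonneg _ _) (hd.le_one l (mem_filter.1 hl).2)

/-- Both coefficients on the right of the recursion are strictly positive for `x ≤ n`, so one
positive term suffices. -/
theorem q_pos_of_succ (hp : IsPartitionStructure p) (hr : RegenerativeWith p d)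
    (h1 : ∀ k < n, 0 < massOf p (Multiset.replicate k 1)) {x : ℕ} (hx : x ∈ Icc 1 n)
    (h : 0 < q p (n + 1) (d (n + 1)) x ∨ 0 < q p (n + 1) (d (n + 1)) (x + 1)) :
    0 < q p n (d n) x := by
  have key := q_recursion hp (hr n) (hr (n + 1)) h1 hx
  have hxn : (x : ℝ) ≤ n := by exact_mod_cast (mem_Icc.1 hx).2
  have hx0 : (0 : ℝ) ≤ x := x.cast_nonneg
  have ha := q_nonneg hp (hr (n + 1)).1 x
  have hb := q_nonneg hp (hr (n + 1)).1 (x + 1)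
  have hc := q_le_one hp (hr (n + 1)).1 1
  have hn1 : (1 : ℝ) ≤ n := by exact_mod_cast (mem_Icc.1 hx).1.trans (mem_Icc.1 hx).2
  generalize q p (n + 1) (d (n + 1)) (x + 1) = b at *
  generalize q p (n + 1) (d (n + 1)) x = a at *
  generalize q p (n + 1) (d (n + 1)) 1 = c at *
  have hpos : 0 < ((x : ℝ) + 1) * b + ((n : ℝ) + 1 - x) * a := by
    rcases h with h | h
    · exact add_pos_of_nonneg_of_pos (by positivity) (mul_pos (by linarith) h)
    · exact add_pos_of_pos_of_nonneg (by positivity) (mul_nonneg (by linarith) ha)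
  rw [← key] at hpos
  exact pos_of_mul_pos_right hpos (by linarith)

theorem q_pos (hp : IsPartitionStructure p) (hr : RegenerativeWith p d)
    (h22 : 0 < massOf p {2, 2}) {x : ℕ} (hx : x ∈ Icc 1 n) : 0 < q p n (d n) x := by
  have h1 : ∀ N, ∀ k < N, 0 < massOf p (Multiset.replicate k 1) := fun _ k _ =>
    massOf_pos hp hr h22 fun i hi => by simp [Multiset.eq_of_mem_replicate hi]
  obtain ⟨hx1, hxn⟩ := mem_Icc.1 hx
  -- From level $2n$ and part $n$, take $x$ steps lowering only the level; then $n-x$ steps lowering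
  -- level and part together end at level $n$ and part $x$.
  have keep : ∀ j ≤ n, 0 < q p (n + (n - j)) (d (n + (n - j))) n := by
    intro j
    induction j with
    | zero => exact fun _ => q_double_pos hp hr h22 (by omega)
    | succ j ih =>
      intro hj
      refine q_pos_of_succ hp hr (h1 _) (mem_Icc.2 ⟨by omega, by omega⟩) (Or.inl ?_)
      rw [show n + (n - (j + 1)) + 1 = n + (n - j) by omega]
      exact ih (by omega)
  have lower : ∀ j ≤ n - x, 0 < q p (n + (n - x) - j) (d (n + (n - x) - j)) (n - j) := by
    intro j
    induction j with
    | zero => exact fun _ => keep x hxn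
    | succ j ih =>
      intro hj
      refine q_pos_of_succ hp hr (h1 _) (mem_Icc.2 ⟨by omega, by omega⟩) (Or.inr ?_)
      rw [show n + (n - x) - (j + 1) + 1 = n + (n - x) - j by omega,
        show n - (j + 1) + 1 = n - j by omega]
      exact ih (by omega)
  have := lower (n - x) le_rfl
  rwa [Nat.add_sub_cancel, Nat.sub_sub_self hxn] at this

end

/-! ### Mutual determination of the laws -/

theorem expect_eq_of_le (hp : IsPartitionStructure p) (hp' : IsPartitionStructure p')
    (h : p n = p' n) (hmn : m ≤ n) (F : Multiset ℕ → ℝ) : expect p m F = expect p' m F := by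
  simp only [expect_eq_sum_setLaw hp hmn, expect_eq_sum_setLaw hp' hmn, setLaw, h]

theorem massOf_eq_of_expect_eq {s : Multiset ℕ}
    (h : ∀ F : Multiset ℕ → ℝ, expect p s.sum F = expect p' s.sum F) :
    massOf p s = massOf p' s := by
  rw [← expect_indicator rfl, h, expect_indicator rfl]

theorem eq_of_expect_eq (h : ∀ F : Multiset ℕ → ℝ, expect p n F = expect p' n F) :
    p n = p' n := by
  funext l
  rw [← massOf_parts (p := p), ← massOf_parts (p := p')]
  exact massOf_eq_of_expect_eq (l.parts_sum.symm ▸ h)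

/-- Equality at level `n` descends to lower levels by consistency, so both deletion laws mix the
same family; positivity is therefore needed for `p` alone. -/
theorem q_eq_of_eq (hp : IsPartitionStructure p) (hp' : IsPartitionStructure p') (hn : n ≠ 0)
    {d d' : n.Partition → ℕ → ℝ} (hr : RegenerativeAt p n d) (hr' : RegenerativeAt p' n d')
    (hpos : ∀ k < n, 0 < massOf p (Multiset.replicate k 1)) (h : p n = p' n) :
    ∀ x ∈ Icc 1 n, q p n d x = q p' n d' x := by
  refine eq_of_sum_mul_expect_eq hpos fun F => ?_
  rw [← expect_eq_sum_q hr hn, expect_eq_of_le hp hp' h le_rfl, expect_eq_sum_q hr' hn]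
  exact sum_congr rfl fun x _ => by rw [expect_eq_of_le hp hp' h (Nat.sub_le n x)]

theorem kernel_eq_of_eq (hp : IsPartitionStructure p) (hp' : IsPartitionStructure p')
    {d d' : n.Partition → ℕ → ℝ} (hr : RegenerativeAt p n d) (hr' : RegenerativeAt p' n d')
    (hpos : ∀ l, 0 < p n l) (h : p n = p' n) (hq : ∀ x ∈ Icc 1 n, q p n d x = q p' n d' x) :
    d = d' := by
  funext l x
  by_cases hx : x ∈ l.parts
  · have hxn : x ≤ n := (Multiset.le_sum_of_mem hx).trans_eq l.parts_sum
    have hsum : (l.parts.erase x).sum ≤ n := by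
      have h1 := Multiset.sum_erase hx
      rw [l.parts_sum] at h1
      omega
    refine mul_left_cancel₀ (hpos l).ne' ?_
    rw [hr.mul_eq hx, hq x (mem_Icc.2 ⟨l.parts_pos hx, hxn⟩),
      massOf_eq_of_expect_eq fun F => expect_eq_of_le hp hp' h hsum F, ← hr'.mul_eq hx, h]
  · rw [hr.1.eq_zero l x hx, hr'.1.eq_zero l x hx]

/-- Adjoin the part `n - k` to `k` singletons, staying positive by regeneration, then lower that
part to 1. This gives positivity for the second structure too, knowing only its deletion law at
level `n`. -/
theorem massOf_replicate_pos_of_q_pos (hp : IsPartitionStructure p) {d : n.Partition → ℕ → ℝ}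
    (hr : RegenerativeAt p n d) (hq : ∀ x ∈ Icc 1 n, 0 < q p n d x) {k : ℕ} (hk : k ≤ n) :
    0 < massOf p (Multiset.replicate k 1) := by
  induction k with
  | zero => simp [massOf_zero hp]
  | succ k ih =>
    rw [Multiset.replicate_succ]
    refine massOf_pos_cons_of_le hp one_pos (by omega : 1 ≤ n - k) ?_
    exact massOf_pos_cons_of_q_pos hp hr (by omega) (by simp; omega)
      (hq _ (mem_Icc.2 ⟨by omega, by omega⟩)) (ih (by omega))

theorem expect_zero (hp : IsPartitionStructure p) (F : Multiset ℕ → ℝ) : expect p 0 F = F 0 := by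
  have h := hp.sum_eq_one 0
  rw [Fintype.sum_unique] at h
  rw [expect, Fintype.sum_unique, h, one_mul]
  simp

/-- Two partition structures with the same deletion law at level `n` coincide up to level `n`. -/
theorem eq_of_q_eq {d d' : ∀ n : ℕ, n.Partition → ℕ → ℝ} (hp : IsPartitionStructure p)
    (hp' : IsPartitionStructure p') (hr : RegenerativeWith p d) (hr' : RegenerativeWith p' d')
    (hpos : ∀ x ∈ Icc 1 n, 0 < q p n (d n) x)
    (hq : ∀ x ∈ Icc 1 n, q p n (d n) x = q p' n (d' n) x) : p n = p' n := by
  have h1 : ∀ k ≤ n, 0 < massOf p (Multiset.replicate k 1) := fun k hk =>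
    massOf_replicate_pos_of_q_pos hp (hr n) hpos hk
  have h1' : ∀ k ≤ n, 0 < massOf p' (Multiset.replicate k 1) := fun k hk =>
    massOf_replicate_pos_of_q_pos hp' (hr' n) (fun x hx => hq x hx ▸ hpos x hx) hk
  have hqm : ∀ m ≤ n, ∀ x ∈ Icc 1 m, q p m (d m) x = q p' m (d' m) x := by
    intro m hm
    induction hm using Nat.decreasingInduction with
    | self => exact hq
    | of_succ m hm ih =>
      intro x hx
      obtain ⟨hx1, hxm⟩ := mem_Icc.1 hx
      have e := q_recursion hp (hr m) (hr (m + 1)) (fun k hk => h1 k (by omega)) hx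
      have e' := q_recursion hp' (hr' m) (hr' (m + 1)) (fun k hk => h1' k (by omega)) hx
      rw [ih 1 (mem_Icc.2 ⟨le_rfl, by omega⟩), ih x (mem_Icc.2 ⟨hx1, by omega⟩),
        ih (x + 1) (mem_Icc.2 ⟨by omega, by omega⟩), ← e'] at e
      have hle := q_le_one hp' (hr' (m + 1)).1 1
      have hm1 : (1 : ℝ) ≤ m := by exact_mod_cast hx1.trans hxm
      -- The cancelled factor $m+1-q'(m+1,1)$ is at least $m\ge1$.
      exact mul_left_cancel₀ (by linarith) e
  refine eq_of_expect_eq ?_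
  suffices h : ∀ m ≤ n, ∀ F : Multiset ℕ → ℝ, expect p m F = expect p' m F from h n le_rfl
  intro m
  induction m using Nat.strong_induction_on with
  | _ m ih =>
    intro hm F
    rcases Nat.eq_zero_or_pos m with rfl | hm0
    · rw [expect_zero hp, expect_zero hp']
    · rw [expect_eq_sum_q (hr m) hm0.ne', expect_eq_sum_q (hr' m) hm0.ne']
      refine sum_congr rfl fun x hx => ?_
      have hx' := mem_Icc.1 hx
      rw [hqm m hm x hx, ih (m - x) (by omega) (by omega)]

/-- Some non-hook has positive mass: discard all but two of its parts larger than 1, then lower both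
to 2. -/
theorem massOf_two_two_pos (hp : IsPartitionStructure p) (h : ¬ IsHookStructure p) :
    0 < massOf p {2, 2} := by
  have hex : ∃ n, ∃ l : n.Partition, ¬ IsHook l ∧ 0 < p n l := by
    by_contra! hcon
    refine h fun n => ?_
    rw [← hp.sum_eq_one n]
    refine sum_subset (filter_subset _ _) fun l _ hl => ?_
    exact (hcon n l fun hh => hl (mem_filter.2 ⟨mem_univ _, hh⟩)).antisymm (hp.nonneg _ _)
  obtain ⟨n, l, hl, hpl⟩ := hex
  rw [IsHook, not_le] at hl
  rw [← massOf_parts (p := p)] at hpl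
  obtain ⟨a, ha⟩ := Multiset.card_pos_iff_exists_mem.1 (by omega :
    0 < (l.parts.filter (fun i => 1 < i)).card)
  obtain ⟨t, ht⟩ := Multiset.exists_cons_of_mem ha
  rw [ht, Multiset.card_cons] at hl
  obtain ⟨b, hb⟩ := Multiset.card_pos_iff_exists_mem.1 (by omega : 0 < t.card)
  obtain ⟨u, rfl⟩ := Multiset.exists_cons_of_mem hb
  have hb2 : 1 < b := by
    have : b ∈ l.parts.filter (fun i => 1 < i) := by rw [ht]; simp
    exact (Multiset.mem_filter.1 this).2
  obtain ⟨v, hv⟩ := Multiset.le_iff_exists_add.1 (Multiset.filter_le (fun i => 1 < i) l.parts)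
  have hl' : l.parts = (u + v) + {a, b} := by
    rw [hv, ht, add_comm (u + v), Multiset.cons_add, Multiset.cons_add,
      Multiset.insert_eq_cons, add_comm, Multiset.cons_add, Multiset.singleton_add]
  rw [hl'] at hpl
  have h1 := massOf_pos_cons_of_le hp two_pos (Multiset.mem_filter.1 ha).2
    (massOf_pos_of_add hp hpl)
  rw [← Multiset.cons_zero, Multiset.cons_swap] at h1
  exact massOf_pos_cons_of_le hp two_pos hb2 h1

theorem regenerativeAt_zero_eq {d d' : Nat.Partition 0 → ℕ → ℝ} (h : IsDeletionKernel 0 d)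
    (h' : IsDeletionKernel 0 d') : d = d' := by
  funext l x
  rw [h.eq_zero l x (by simp), h'.eq_zero l x (by simp)]

end PartStruct

/-! ### The main theorem -/

theorem mainTheorem10 :
    (∀ (p : ∀ n : ℕ, n.Partition → ℝ) (d : ∀ n : ℕ, n.Partition → ℕ → ℝ),
      PartStruct.IsPartitionStructure p → PartStruct.RegenerativeWith p d →
      0 < p 4 PartStruct.twoTwo →
      ∀ (p' : ∀ n : ℕ, n.Partition → ℝ) (d' : ∀ n : ℕ, n.Partition → ℕ → ℝ),
        PartStruct.IsPartitionStructure p' → PartStruct.RegenerativeWith p' d' →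
        ∀ n : ℕ, 1 ≤ n →
          ((∀ x : ℕ, 1 ≤ x → x ≤ n → PartStruct.q p n (d n) x = PartStruct.q p' n (d' n) x) →
            p n = p' n ∧ d n = d' n) ∧
          (p n = p' n →
            (∀ x : ℕ, 1 ≤ x → x ≤ n → PartStruct.q p n (d n) x = PartStruct.q p' n (d' n) x) ∧
            d n = d' n)) ∧
    (∀ p : ∀ n : ℕ, n.Partition → ℝ,
      PartStruct.IsPartitionStructure p → PartStruct.IsRegenerative p →
      ¬ PartStruct.IsHookStructure p →
      ∃! d : ∀ n : ℕ, n.Partition → ℕ → ℝ, PartStruct.RegenerativeWith p d) := by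
  have uniq : ∀ (p : ∀ n : ℕ, n.Partition → ℝ) (d : ∀ n : ℕ, n.Partition → ℕ → ℝ),
      PartStruct.IsPartitionStructure p → PartStruct.RegenerativeWith p d →
      0 < PartStruct.massOf p {2, 2} →
      ∀ (p' : ∀ n : ℕ, n.Partition → ℝ) (d' : ∀ n : ℕ, n.Partition → ℕ → ℝ),
        PartStruct.IsPartitionStructure p' → PartStruct.RegenerativeWith p' d' →
        ∀ n : ℕ, 1 ≤ n → p n = p' n →
          (∀ x ∈ Finset.Icc 1 n, PartStruct.q p n (d n) x = PartStruct.q p' n (d' n) x) ∧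
            d n = d' n := by
    intro p d hp hr h22 p' d' hp' hr' n hn h
    have hq := PartStruct.q_eq_of_eq hp hp' (by omega) (hr n) (hr' n)
      (fun k _ => PartStruct.massOf_pos hp hr h22 fun i hi => by
        simp [Multiset.eq_of_mem_replicate hi]) h
    refine ⟨hq, PartStruct.kernel_eq_of_eq hp hp' (hr n) (hr' n) (fun l => ?_) h hq⟩
    rw [← PartStruct.massOf_parts (p := p)]
    exact PartStruct.massOf_pos hp hr h22 fun i hi => l.parts_pos hi
  refine ⟨fun p d hp hr h22 p' d' hp' hr' n hn => ?_, fun p hp hreg hhook => ?_⟩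
  · rw [← PartStruct.massOf_parts (p := p)] at h22
    have hb := uniq p d hp hr h22 p' d' hp' hr' n hn
    refine ⟨fun hq => ?_, fun h => ⟨fun x hx hxn => (hb h).1 x (Finset.mem_Icc.2 ⟨hx, hxn⟩),
      (hb h).2⟩⟩
    have h := PartStruct.eq_of_q_eq hp hp' hr hr' (fun x hx => PartStruct.q_pos hp hr h22 hx)
      fun x hx => hq x (Finset.mem_Icc.1 hx).1 (Finset.mem_Icc.1 hx).2
    exact ⟨h, (hb h).2⟩
  · choose d hd using hreg
    refine ⟨d, hd, fun d' hd' => funext fun n => ?_⟩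
    -- Level 0 is separate: both kernels vanish on the empty partition by convention. At positive
    -- levels, uniqueness is the comparison of `p` with itself under two kernels.
    rcases Nat.eq_zero_or_pos n with rfl | hn
    · exact PartStruct.regenerativeAt_zero_eq (hd' 0).1 (hd 0).1
    · exact (uniq p d' hp hd' (PartStruct.massOf_two_two_pos hp hhook) p d hp hd n hn rfl).2
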